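/- Let $p$ be a prime, let $k,t,d$ be positive integers, let $n=2kt$, and suppose that $\gcd(d,p^n-1)=p^t+1$. Let $G:\mathbb{F}_{p^n}\to\mathbb{F}_{p^n}$ be a function such that $F(x)=G(x^d)$ is quadratic, that is, in the unique polynomial of degree at most $p^n-1$ representing $F$ on $\mathbb{F}_{p^n}$, the largest $p$-weight (sum of base-$p$ digits) of an exponent with nonzero coefficient is $2$. Assume that the restriction of $G$ to $C_d=\{x^d : x\in\mathbb{F}_{p^n}\}$ (which contains $0$) is injective. Let $\mathrm{Tr}$ denote the trace from $\mathbb{F}_{p^n}$ to $\mathbb{F}_p$. Then for every nonzero $a\in\mathbb{F}_{p^n}$, the set $$E_a=\{s\in\mathbb{F}_{p^n} : \mathrm{Tr}\big(a(F(y+s)-F(y))\big)=0\ \text{for all } y\in\mathbb{F}_{p^n}\}$$ is an $\mathbb{F}_p$-linear subspace of $\mathbb{F}_{p^n}$, and $|E_a|$ is either $1$ or $p^{2t}$. -/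

import Mathlib

/-- The `p`-weight of `i`: the sum (in `ℕ`) of the digits of `i` in base `p`. -/
def pWeight (p i : ℕ) : ℕ := (Nat.digits p i).sum

open Classical in
/-- The unique polynomial of degree less than `|K|` that induces the function `F : K → K`
on the finite field `K`. -/
noncomputable def reducedPoly {K : Type*} [Field K] [Fintype K] (F : K → K) : Polynomial K :=
  Lagrange.interpolate Finset.univ (id : K → K) F

/-- The algebraic degree of `F : K → K`: the largest `p`-weight of an exponent that occurs
with nonzero coefficient in the reduced polynomial of `F`. -/
noncomputable def algDegree (p : ℕ) {K : Type*} [Field K] [Fintype K] (F : K → K) : ℕ :=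
  (reducedPoly F).support.sup (pWeight p)

/-- `F : K → K` is quadratic if its algebraic degree is `2`. -/
def IsQuadraticMap (p : ℕ) {K : Type*} [Field K] [Fintype K] (F : K → K) : Prop :=
  algDegree p F = 2

/-- The set `C_d` of all `d`-th powers of elements of `K` (with `0 = 0 ^ d` included). -/
def powerSet (K : Type*) [Field K] (d : ℕ) : Set K := Set.range fun x : K => x ^ d

/-- The `𝔽_p`-linear space `E_a` of all `s` with `Tr (a (F (y + s) - F y)) = 0` for all `y`,
where `Tr` is the absolute trace of `K`. -/
noncomputable def traceVanishingSpace (p : ℕ) [Fact p.Prime] {K : Type*} [Field K]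
    [Algebra (ZMod p) K] (F : K → K) (a : K) : Submodule (ZMod p) K where
  carrier := {s | ∀ y : K, Algebra.trace (ZMod p) K (a * (F (y + s) - F y)) = 0}
  zero_mem' := by intro y; simp
  add_mem' := by
    intro s s' hs hs' y
    have h : a * (F (y + (s + s')) - F y)
        = a * (F ((y + s) + s') - F (y + s)) + a * (F (y + s) - F y) := by
      rw [← add_assoc]; ring
    rw [h, map_add, hs y, hs' (y + s), add_zero]
  smul_mem' := by
    intro c s hs
    have key : ∀ m : ℕ, ∀ y : K,
        Algebra.trace (ZMod p) K (a * (F (y + (m : ZMod p) • s) - F y)) = 0 := by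
      intro m
      induction m with
      | zero => intro y; simp
      | succ m ih =>
        intro y
        have h : a * (F (y + ((m + 1 : ℕ) : ZMod p) • s) - F y)
            = a * (F ((y + (m : ZMod p) • s) + s) - F (y + (m : ZMod p) • s))
              + a * (F (y + (m : ZMod p) • s) - F y) := by
          rw [Nat.cast_succ, add_smul, one_smul, ← add_assoc]; ring
        rw [h, map_add, hs _, ih y, add_zero]
    have := key c.val
    rwa [ZMod.natCast_zmod_val] at this

/-! Write q = p^t, so |K| = q^(2k), and Q = F - F(0). Since q + 1 divides d, F is invariant under an
element ζ of order q + 1, so every exponent of F is divisible by q + 1. Such a nonzero exponent of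
weight at most 2 must be p^i (q^(2u+1) + 1). Hence Q behaves like a Hermitian form over the field L
of order q^2, and E_a, the radical of its traced polar form, is an L-space: |E_a| = q^(2 r_a).

Let S(a) be the sum of χ(a Q(x)) over x. A scalar of norm -1 turns Q into -Q, which gives S(a)^2 =
|K| |E_a|. The map x ↦ x^d is (q+1)-to-one off 0, so S(a) ≡ 1 modulo q + 1 among algebraic integers;
this fixes the sign: S(a) = (-q)^(k + r_a).

Injectivity of G on C_d determines the first two moments of S. Removing a = 0, where r_0 = k, leaves
numbers z_a = (-q)^(r_a) with sum 0 and mean square q. Thus the (z_a - 1)(z_a + q) sum to 0. Each is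
nonnegative, so z_a is 1 or -q. -/

/-! ### Exponents of weight at most 2 divisible by q + 1 -/

/-- Natural numbers of `p`-weight at most `2`. -/
theorem eq_pow_add_pow_of_pWeight_le_two {p : ℕ} (hp : 1 < p) (e : ℕ) :
    (pWeight p e = 0 → e = 0) ∧ (pWeight p e = 1 → ∃ i, e = p ^ i) ∧
      (pWeight p e = 2 → ∃ i m, e = p ^ i * (p ^ m + 1)) := by
  induction e using Nat.strong_induction_on with
  | _ e ih =>
    rcases Nat.eq_zero_or_pos e with rfl | he
    · simp [pWeight]
    have hw : pWeight p e = e % p + pWeight p (e / p) := by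
      simp [pWeight, Nat.digits_def' hp he]
    obtain ⟨h0, h1, h2⟩ := ih (e / p) (Nat.div_lt_self he hp)
    have hdm := Nat.div_add_mod e p
    generalize e / p = f at *
    generalize e % p = r at *
    refine ⟨fun h => ?_, fun h => ?_, fun h => ?_⟩
    · have := h0 (by omega)
      have : r = 0 := by omega
      subst_vars; simp
    · rcases Nat.eq_zero_or_pos r with rfl | hr
      · obtain ⟨i, rfl⟩ := h1 (by omega)
        exact ⟨i + 1, by rw [← hdm]; ring⟩
      · have := h0 (by omega)
        have : r = 1 := by omega
        subst_vars; exact ⟨0, by simp⟩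
    · obtain rfl | rfl | rfl : r = 0 ∨ r = 1 ∨ r = 2 := by omega
      · obtain ⟨i, m, rfl⟩ := h2 (by omega)
        exact ⟨i + 1, m, by rw [← hdm]; ring⟩
      · obtain ⟨i, rfl⟩ := h1 (by omega)
        exact ⟨0, i + 1, by rw [← hdm]; ring⟩
      · have := h0 (by omega)
        subst_vars; exact ⟨0, 0, by simp⟩

/-- Modulo p^t + 1 one has p^t ≡ -1, so lowering m by 2t preserves the divisibility; the descent
stops at m = t. -/
theorem exists_eq_mul_odd_of_pow_add_one_dvd {p t m : ℕ} (hp : 1 < p) (ht : 0 < t)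
    (h : p ^ t + 1 ∣ p ^ m + 1) : ∃ u, m = t * (2 * u + 1) := by
  induction m using Nat.strong_induction_on with
  | _ m ih =>
    have hle : t ≤ m := by
      have := Nat.le_of_dvd (by positivity) h
      exact (Nat.pow_le_pow_iff_right hp).1 (by omega)
    rcases hle.eq_or_lt with rfl | hlt
    · exact ⟨0, by simp⟩
    obtain ⟨v, rfl⟩ := Nat.exists_eq_add_of_le hle
    have h1 : p ^ t + 1 ∣ p ^ v - 1 := by
      have hv : 1 ≤ p ^ v := Nat.one_le_pow _ _ (by omega)
      have h3 : p ^ t * (p ^ v - 1) + (p ^ t + 1) = p ^ (t + v) + 1 := by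
        zify [hv]; ring
      have h4 : p ^ t + 1 ∣ p ^ t * (p ^ v - 1) := by
        rw [← h3] at h; exact (Nat.dvd_add_left dvd_rfl).1 h
      exact Nat.Coprime.dvd_of_dvd_mul_left (by simp) h4
    have hv : p ^ t + 1 ≤ p ^ v - 1 := by
      refine Nat.le_of_dvd ?_ h1
      have := Nat.one_lt_pow (n := v) (by omega) hp
      omega
    have htv : t ≤ v := by
      refine ((Nat.pow_le_pow_iff_right hp).1 ?_ : t ≤ v)
      omega
    obtain ⟨w, rfl⟩ := Nat.exists_eq_add_of_le htv
    have h5 : p ^ t + 1 ∣ p ^ w + 1 := by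
      have hw : 1 ≤ p ^ (t + w) := Nat.one_le_pow _ _ (by omega)
      have h3 : p ^ (t + w) - 1 + (p ^ w + 1) = p ^ w * (p ^ t + 1) := by
        zify [hw]; ring
      exact (Nat.dvd_add_right h1).1 (h3 ▸ dvd_mul_left _ _)
    obtain ⟨u, rfl⟩ := ih w (by omega) h5
    exact ⟨u + 1, by ring⟩

theorem eval_reducedPoly {K : Type*} [Field K] [Fintype K] (F : K → K) (x : K) :
    (reducedPoly F).eval x = F x := by
  classical
  have := Lagrange.eval_interpolate_at_node (v := (id : K → K)) F (Set.injOn_id _)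
    (Finset.mem_univ x)
  unfold reducedPoly
  rw [id] at this
  convert this

theorem degree_reducedPoly_lt {K : Type*} [Field K] [Fintype K] (F : K → K) :
    (reducedPoly F).degree < Fintype.card K := by
  classical
  have := Lagrange.degree_interpolate_lt (s := Finset.univ) (v := (id : K → K)) F
    (Set.injOn_id _)
  rw [Finset.card_univ] at this
  unfold reducedPoly
  convert this

/-- If `F (ζ * x) = F x` for all `x`, the exponents of `F` are killed by `ζ`. -/
theorem pow_eq_one_of_mem_support_reducedPoly {K : Type*} [Field K] [Fintype K] {F : K → K}
    {ζ : K} (hF : ∀ x, F (ζ * x) = F x) {e : ℕ} (he : e ∈ (reducedPoly F).support) :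
    ζ ^ e = 1 := by
  have h : (reducedPoly F).comp (Polynomial.C ζ * Polynomial.X) = reducedPoly F := by
    refine Polynomial.eq_of_degrees_lt_of_eval_finset_eq Finset.univ ?_ ?_ ?_
    · refine lt_of_le_of_lt ?_ (degree_reducedPoly_lt F)
      refine (Polynomial.degree_le_iff_coeff_zero _ _).2 fun m hm => ?_
      rw [Polynomial.comp_C_mul_X_coeff, Polynomial.coeff_eq_zero_of_degree_lt hm, zero_mul]
    · exact degree_reducedPoly_lt F
    · intro x _
      simp [eval_reducedPoly, hF]
  have h2 := congrArg (fun P => P.coeff e) h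
  simp only [Polynomial.comp_C_mul_X_coeff] at h2
  exact (mul_eq_left₀ (Polynomial.mem_support_iff.1 he)).1 h2

theorem pow_pow_mul_odd {M : Type*} [Monoid M] {x : M} {q : ℕ} (h : x ^ q ^ 2 = x) (u : ℕ) :
    x ^ q ^ (2 * u + 1) = x ^ q := by
  induction u with
  | zero => simp
  | succ u ih =>
    rw [show q ^ (2 * (u + 1) + 1) = q ^ 2 * q ^ (2 * u + 1) by ring, pow_mul, h, ih]

/-! ### Hermitian structure of F - F(0) -/

/-- A map `Q` on `K` that behaves as a Hermitian form over the subfield of order `q ^ 2`,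
composed with additive maps. -/
structure IsHermitianLike {K : Type*} [Field K] (q : ℕ) (Q : K → K) : Prop where
  polar_add : ∀ x y z, Q (x + y + z) - Q x - Q (y + z) =
    (Q (x + y) - Q x - Q y) + (Q (x + z) - Q x - Q z)
  polar_mul : ∀ c x y, c ^ q ^ 2 = c → Q (c * x + y) - Q (c * x) - Q y =
    Q (x + c ^ q * y) - Q x - Q (c ^ q * y)
  map_mul : ∀ c x, c ^ q ^ 2 = c → c ^ (q + 1) = -1 → Q (c * x) = - Q x

theorem IsHermitianLike.sum {K ι : Type*} [Field K] {q : ℕ} (s : Finset ι) (Q : ι → K → K)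
    (h : ∀ i ∈ s, IsHermitianLike q (Q i)) : IsHermitianLike q (fun x => ∑ i ∈ s, Q i x) where
  polar_add x y z := by
    simp only [← Finset.sum_sub_distrib, ← Finset.sum_add_distrib]
    exact Finset.sum_congr rfl fun i hi => (h i hi).polar_add x y z
  polar_mul c x y hc := by
    simp only [← Finset.sum_sub_distrib]
    exact Finset.sum_congr rfl fun i hi => (h i hi).polar_mul c x y hc
  map_mul c x hc hc' := by
    simp only [← Finset.sum_neg_distrib]
    exact Finset.sum_congr rfl fun i hi => (h i hi).map_mul c x hc hc'

/-- On scalars fixed by the q^2-power map, raising to an odd power of q is the same as raising to q;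
the monomial is thus a Frobenius twist of a Hermitian norm. -/
theorem isHermitianLike_monomial {K : Type*} [Field K] (p : ℕ) [Fact p.Prime] [CharP K p]
    (t i u : ℕ) (c : K) :
    IsHermitianLike (p ^ t) (fun x : K => c * x ^ (p ^ i * (p ^ (t * (2 * u + 1)) + 1))) := by
  have hadd : ∀ x y : K, (x + y) ^ (p ^ i * (p ^ (t * (2 * u + 1)) + 1)) =
      (x ^ p ^ (i + t * (2 * u + 1)) + y ^ p ^ (i + t * (2 * u + 1))) *
        (x ^ p ^ i + y ^ p ^ i) := by
    intro x y
    rw [← add_pow_char_pow, ← add_pow_char_pow, mul_add, mul_one, ← pow_add, pow_add]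
  have hone : ∀ x : K, x ^ (p ^ i * (p ^ (t * (2 * u + 1)) + 1)) =
      x ^ p ^ (i + t * (2 * u + 1)) * x ^ p ^ i := by
    intro x
    rw [mul_add, mul_one, ← pow_add, pow_add]
  have hL : ∀ x : K, x ^ (p ^ t) ^ 2 = x →
      x ^ p ^ (i + t * (2 * u + 1)) = (x ^ p ^ t) ^ p ^ i := by
    intro x hx
    rw [add_comm, pow_add, pow_mul p t, pow_mul x, pow_pow_mul_odd hx]
  refine ⟨fun x y z => ?_, fun b x y hb => ?_, fun b x hb hb' => ?_⟩
  · rw [add_assoc x y z]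
    simp only [hadd, hone, add_pow_char_pow]; ring
  · have hb2 : (b ^ p ^ t) ^ (p ^ t) ^ 2 = b ^ p ^ t := by rw [pow_right_comm, hb]
    have hb3 : (b ^ p ^ t) ^ p ^ t = b := by rw [← pow_mul, ← sq, hb]
    simp only [hadd, hone, mul_pow, hL b hb, hL _ hb2, hb3]; ring
  · have : b ^ (p ^ i * (p ^ (t * (2 * u + 1)) + 1)) = -1 := by
      rw [hone, hL b hb, ← mul_pow, ← pow_succ, hb', neg_one_pow_char_pow]
    rw [mul_pow, this]; ring

/-- A quadratic map invariant under multiplication by an element of order `p ^ t + 1` becomes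
Hermitian-like after subtracting its value at `0`. -/
theorem isHermitianLike_of_isQuadraticMap {K : Type*} [Field K] [Fintype K] (p : ℕ)
    [hp : Fact p.Prime] [CharP K p] {t : ℕ} (ht : 0 < t) {F : K → K} (hF : IsQuadraticMap p F)
    {ζ : K} (hζ : orderOf ζ = p ^ t + 1) (hFζ : ∀ x, F (ζ * x) = F x) :
    IsHermitianLike (p ^ t) (fun x => F x - F 0) := by
  have hp1 := hp.out.one_lt
  have hsupp : ∀ e ∈ (reducedPoly F).support.erase 0,
      ∃ i u, e = p ^ i * (p ^ (t * (2 * u + 1)) + 1) := by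
    intro e he
    rw [Finset.mem_erase] at he
    have hdvd : p ^ t + 1 ∣ e :=
      hζ ▸ orderOf_dvd_of_pow_eq_one (pow_eq_one_of_mem_support_reducedPoly hFζ he.2)
    have hw : pWeight p e ≤ 2 := by
      rw [← hF]; exact Finset.le_sup (f := pWeight p) he.2
    have hcop : ∀ i, Nat.Coprime (p ^ t + 1) (p ^ i) := fun i => by
      refine Nat.Coprime.pow_right _ ?_
      obtain ⟨s, rfl⟩ := Nat.exists_eq_add_of_lt ht
      rw [zero_add, pow_succ]
      simp
    obtain ⟨h0, h1, h2⟩ := eq_pow_add_pow_of_pWeight_le_two hp1 e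
    obtain h | h | h : pWeight p e = 0 ∨ pWeight p e = 1 ∨ pWeight p e = 2 := by omega
    · exact absurd (h0 h) he.1
    · obtain ⟨i, rfl⟩ := h1 h
      have := Nat.Coprime.eq_one_of_dvd (hcop i) hdvd
      have := Nat.one_lt_pow ht.ne' hp1
      omega
    · obtain ⟨i, m, rfl⟩ := h2 h
      obtain ⟨u, rfl⟩ := exists_eq_mul_odd_of_pow_add_one_dvd hp1 ht
        ((hcop i).dvd_of_dvd_mul_left hdvd)
      exact ⟨i, u, rfl⟩
  have hsum : ∀ x, F x - F 0 =
      ∑ e ∈ (reducedPoly F).support.erase 0, (reducedPoly F).coeff e * x ^ e := by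
    intro x
    have h : ∀ y, F y = ∑ e ∈ (reducedPoly F).support, (reducedPoly F).coeff e * y ^ e := by
      intro y
      rw [← eval_reducedPoly F y, Polynomial.eval_eq_sum, Polynomial.sum]
    rw [h x, h 0, ← Finset.sum_sub_distrib]
    symm
    refine Finset.sum_subset_zero_on_sdiff (Finset.erase_subset _ _) ?_ ?_
    · intro e he
      obtain rfl : e = 0 := by
        by_contra h0
        simp [h0] at he
      simp
    · intro e he
      simp [(Finset.mem_erase.1 he).1]
  simp only [hsum]
  refine IsHermitianLike.sum _ _ fun e he => ?_
  obtain ⟨i, u, rfl⟩ := hsupp e he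
  exact isHermitianLike_monomial p t i u _

/-! ### Power fibres, subfields and norms in finite fields -/

theorem card_pow_eq_pow {K : Type*} [Field K] [Fintype K] (d : ℕ) (hd : 0 < d) {x : K}
    (hx : x ≠ 0) : Nat.card {y : K // y ^ d = x ^ d} = Nat.gcd d (Fintype.card K - 1) := by
  have h := IsCyclic.card_powMonoidHom_ker (G := Kˣ) d
  rw [Nat.card_units, Nat.card_eq_fintype_card (α := K), Nat.gcd_comm] at h
  rw [← h]
  refine Nat.card_congr
    { toFun := fun y => ⟨Units.mk0 (y.1 / x) (div_ne_zero ?_ hx), ?_⟩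
      invFun := fun u => ⟨u.1 * x, ?_⟩
      left_inv := fun y => ?_
      right_inv := fun u => ?_ }
  · rintro h0
    have := y.2
    rw [h0, zero_pow hd.ne'] at this
    exact pow_ne_zero d hx this.symm
  · rw [MonoidHom.mem_ker]
    ext
    simp [div_pow, y.2, hx]
  · have := congrArg Units.val ((MonoidHom.mem_ker).1 u.2)
    simp only [powMonoidHom_apply, Units.val_pow_eq_pow_val, Units.val_one] at this
    rw [mul_pow, this, one_mul]
  · ext; simp [hx]
  · ext; simp [hx]

/-- The subfield of elements fixed by the `m`-th power of the Frobenius. -/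
def frobeniusFixed (K : Type*) [Field K] (p : ℕ) [Fact p.Prime] [CharP K p] (m : ℕ) :
    Subfield K where
  carrier := {x | x ^ p ^ m = x}
  mul_mem' {x y} hx hy := by
    simp only [Set.mem_ofPred_eq] at *
    rw [mul_pow, hx, hy]
  one_mem' := one_pow _
  add_mem' {x y} hx hy := by
    simp only [Set.mem_ofPred_eq] at *
    rw [add_pow_char_pow, hx, hy]
  zero_mem' := zero_pow (pow_ne_zero _ (Fact.out : p.Prime).ne_zero)
  neg_mem' {x} hx := by
    simp only [Set.mem_ofPred_eq] at *
    rw [neg_pow, neg_one_pow_char_pow, hx, neg_one_mul]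
  inv_mem' x hx := by
    simp only [Set.mem_ofPred_eq] at *
    rw [inv_pow, hx]

theorem mem_frobeniusFixed {K : Type*} [Field K] {p : ℕ} [Fact p.Prime] [CharP K p] {m : ℕ}
    {x : K} : x ∈ frobeniusFixed K p m ↔ x ^ p ^ m = x := Iff.rfl

theorem card_frobeniusFixed {K : Type*} [Field K] [Fintype K] {p : ℕ} [hp : Fact p.Prime]
    [CharP K p] {m n : ℕ} (hm : 0 < m) (hmn : m ∣ n) (hK : Fintype.card K = p ^ n) :
    Nat.card (frobeniusFixed K p m) = p ^ m := by
  classical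
  have h1 := Nat.one_lt_pow hm.ne' hp.out.one_lt
  have h := card_pow_eq_pow (K := K) (p ^ m - 1) (by omega) one_ne_zero
  rw [hK, Nat.pow_sub_one_gcd_pow_sub_one, Nat.gcd_eq_left hmn] at h
  have hs : (frobeniusFixed K p m : Set K) = insert 0 {y : K | y ^ (p ^ m - 1) = 1 ^ (p ^ m - 1)} := by
    ext y
    rw [SetLike.mem_coe, mem_frobeniusFixed, Set.mem_insert_iff, Set.mem_ofPred_eq, one_pow]
    rcases eq_or_ne y 0 with rfl | hy
    · simp [hp.out.ne_zero]
    · obtain ⟨r, hr⟩ := Nat.exists_eq_add_of_lt h1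
      rw [hr, show 1 + r + 1 - 1 = r + 1 by omega, show 1 + r + 1 = (r + 1) + 1 by omega,
        pow_succ y (r + 1), mul_eq_right₀ hy]
      simp [hy]
  have h2 : Nat.card (frobeniusFixed K p m) = Set.ncard (frobeniusFixed K p m : Set K) := rfl
  rw [h2, hs, Set.ncard_insert_of_notMem _ (Set.toFinite _)]
  · have h3 : Set.ncard {y : K | y ^ (p ^ m - 1) = 1 ^ (p ^ m - 1)} = p ^ m - 1 := h
    omega
  · rw [Set.mem_ofPred_eq, zero_pow (by omega), one_pow]
    exact zero_ne_one

theorem exists_orderOf_eq {K : Type*} [Field K] [Fintype K] {m : ℕ}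
    (hm : m ∣ Fintype.card K - 1) : ∃ ζ : K, orderOf ζ = m := by
  obtain ⟨g, hg⟩ := IsCyclic.exists_ofOrder_eq_natCard (α := Kˣ)
  rw [Nat.card_units, Nat.card_eq_fintype_card] at hg
  have h0 : orderOf g ≠ 0 := (orderOf_pos g).ne'
  refine ⟨((g ^ (orderOf g / m) : Kˣ) : K), ?_⟩
  rw [orderOf_units]
  exact orderOf_pow_orderOf_div h0 (hg ▸ hm)

/-- The norm from the field of order `q ^ 2` attains `-1`. -/
theorem exists_pow_add_one_eq_neg_one {K : Type*} [Field K] [Fintype K] {p : ℕ}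
    [hp : Fact p.Prime] [CharP K p] {t k : ℕ}
    (hK : Fintype.card K = p ^ (2 * k * t)) :
    ∃ c : K, c ^ (p ^ t) ^ 2 = c ∧ c ^ (p ^ t + 1) = -1 := by
  have key : ∀ c : K, c ^ (p ^ t + 1) = -1 → c ^ (p ^ t) ^ 2 = c := by
    intro c hc
    have hc0 : c ≠ 0 := by rintro rfl; simp at hc
    rw [pow_succ] at hc
    have h2 : (c ^ p ^ t) ^ p ^ t * c ^ p ^ t = -1 := by
      rw [← mul_pow, hc, neg_one_pow_char_pow]
    rw [sq, pow_mul]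
    refine mul_right_cancel₀ (pow_ne_zero (p ^ t) hc0) ?_
    rw [h2, mul_comm, hc]
  suffices ∃ c : K, c ^ (p ^ t + 1) = -1 by
    obtain ⟨c, hc⟩ := this
    exact ⟨c, key c hc, hc⟩
  rcases hp.out.eq_two_or_odd' with rfl | hodd
  · exact ⟨1, by rw [one_pow]; exact (CharTwo.neg_eq 1).symm⟩
  · have hdvd : 2 * (p ^ t + 1) ∣ Fintype.card K - 1 := by
      have h1 : p ^ (2 * t) - 1 ∣ p ^ (2 * k * t) - 1 := by
        apply Nat.pow_sub_one_dvd_pow_sub_one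
        exact ⟨k, by ring⟩
      rw [hK]
      refine dvd_trans ?_ h1
      obtain ⟨r, hr⟩ := hodd.pow (n := t)
      rw [mul_comm 2 t, pow_mul, hr]
      refine ⟨r, ?_⟩
      rw [Nat.sub_eq_iff_eq_add (Nat.one_le_pow _ _ (by omega))]
      ring
    -- For c of order 2(q + 1), the power c^(q+1) has order 2, hence equals -1.
    obtain ⟨c, hc⟩ := exists_orderOf_eq hdvd
    refine ⟨c, ?_⟩
    have h1 : (c ^ (p ^ t + 1)) ^ 2 = 1 := by
      rw [← pow_mul, mul_comm, ← hc, pow_orderOf_eq_one]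
    refine (sq_eq_sq_iff_eq_or_eq_neg.1 (h1.trans (one_pow 2).symm)).resolve_left ?_
    intro h2
    have := Nat.le_of_dvd (by omega) (hc ▸ orderOf_dvd_of_pow_eq_one h2)
    omega

/-! ### The vanishing space as a radical over the field of order q^2 -/

namespace IsHermitianLike

variable {K : Type*} [Field K] {q : ℕ} {Q : K → K}

theorem polar_add_right (h : IsHermitianLike q Q) (x y z : K) :
    QuadraticMap.polar Q x (y + z) = QuadraticMap.polar Q x y + QuadraticMap.polar Q x z := by
  have := h.polar_add x y z
  rwa [add_assoc] at this

theorem polar_add_left (h : IsHermitianLike q Q) (x y z : K) :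
    QuadraticMap.polar Q (x + y) z = QuadraticMap.polar Q x z + QuadraticMap.polar Q y z := by
  rw [QuadraticMap.polar_comm, h.polar_add_right, QuadraticMap.polar_comm _ z,
    QuadraticMap.polar_comm _ z]

theorem polar_mul_right (h : IsHermitianLike q Q) {c : K} (hc : c ^ q ^ 2 = c) (x y : K) :
    QuadraticMap.polar Q x (c * y) = QuadraticMap.polar Q (c ^ q * x) y := by
  rw [QuadraticMap.polar_comm, QuadraticMap.polar_comm _ _ y]
  exact h.polar_mul c y x hc

/-- For a Hermitian-like map, the vanishing space is the radical of the traced polar form. -/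
theorem mem_traceVanishingSpace {p : ℕ} [Fact p.Prime] [Algebra (ZMod p) K] {F : K → K}
    (h : IsHermitianLike q (fun x => F x - F 0)) {ζ : K} (hζ1 : ζ ≠ 1)
    (hζq : (ζ - 1) ^ q ^ 2 = ζ - 1)
    (hF : ∀ x, F (ζ * x) = F x) (a s : K) : s ∈ traceVanishingSpace p F a ↔
      ∀ y, Algebra.trace (ZMod p) K (a * QuadraticMap.polar (fun x => F x - F 0) y s) = 0 := by
  set Q := fun x => F x - F 0 with hQ
  have hQF : ∀ y s, F (y + s) - F y = QuadraticMap.polar Q y s + Q s := by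
    intro y s
    simp only [hQ, QuadraticMap.polar]; ring
  have hmem : ∀ s, s ∈ traceVanishingSpace p F a ↔
      ∀ y, Algebra.trace (ZMod p) K (a * (QuadraticMap.polar Q y s + Q s)) = 0 := by
    intro s
    simp only [← hQF]
    rfl
  rw [hmem]
  have hQ0 : Q 0 = 0 := by simp [hQ]
  refine ⟨fun hs y => ?_, fun hs => ?_⟩
  · have h0 := hs 0
    have h1 := hs y
    have h2 : QuadraticMap.polar Q 0 s = 0 := by simp [QuadraticMap.polar, hQ0]
    rw [h2, zero_add] at h0
    rwa [mul_add, map_add, h0, add_zero] at h1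
  · have hz : ζ - 1 ≠ 0 := sub_ne_zero.2 hζ1
    have hinv : (ζ - 1)⁻¹ ^ q ^ 2 = (ζ - 1)⁻¹ := by rw [inv_pow, hζq]
    obtain ⟨r, hr⟩ : ∃ r, r = (ζ - 1)⁻¹ * s := ⟨_, rfl⟩
    have hsr : s = ζ * r - r := by rw [hr]; field_simp
    have hr' : ∀ y, Algebra.trace (ZMod p) K (a * QuadraticMap.polar Q y r) = 0 := by
      intro y
      rw [hr, h.polar_mul_right hinv]
      exact hs _
    -- Invariance kills the term Q(s): as r + s = ζr, Q(r + s) = Q(r), so Q(s) is minus the polar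
    -- form at (r, s).
    have hQs : Algebra.trace (ZMod p) K (a * Q s) = 0 := by
      have h1 : Q s = - QuadraticMap.polar Q r s := by
        have : Q (r + s) = Q r := by
          rw [hsr]
          simp [hQ, hF]
        rw [QuadraticMap.polar, this]; ring
      rw [h1, mul_neg, map_neg, hs, neg_zero]
    intro y
    rw [mul_add, map_add, hs, hQs, add_zero]

/-- The vanishing space of a Hermitian-like map has cardinality a power of `q ^ 2`. -/
theorem exists_card_traceVanishingSpace [Fintype K] {p : ℕ} [Fact p.Prime] [Algebra (ZMod p) K]
    [CharP K p] {t k : ℕ} (ht : 0 < t) (hK : Fintype.card K = p ^ (2 * k * t)) {F : K → K}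
    (h : IsHermitianLike (p ^ t) (fun x => F x - F 0)) (a : K)
    (hmem : ∀ s, s ∈ traceVanishingSpace p F a ↔
      ∀ y, Algebra.trace (ZMod p) K (a * QuadraticMap.polar (fun x => F x - F 0) y s) = 0) :
    ∃ r, Nat.card (traceVanishingSpace p F a) = p ^ (2 * t * r) := by
  have hcard := card_frobeniusFixed (K := K) (p := p) (m := 2 * t) (by omega) ⟨k, by ring⟩ hK
  let W : Submodule (frobeniusFixed K p (2 * t)) K :=
    { carrier := traceVanishingSpace p F a
      add_mem' := fun hx hy => add_mem hx hy
      zero_mem' := zero_mem _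
      smul_mem' := fun c x hx => by
        have hc : (c : K) ^ (p ^ t) ^ 2 = c := by
          rw [← pow_mul, mul_comm t]; exact c.2
        rw [SetLike.mem_coe, hmem] at *
        intro y
        rw [Subfield.smul_def, smul_eq_mul, h.polar_mul_right hc]
        exact hx _ }
  refine ⟨Module.finrank (frobeniusFixed K p (2 * t)) W, ?_⟩
  rw [pow_mul, ← hcard]
  exact Module.natCard_eq_pow_finrank (K := frobeniusFixed K p (2 * t)) (V := W)

end IsHermitianLike

/-! ### Sign determination -/

/-- An algebraic integer condition modulo `q + 1` determines the sign of a square root. -/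
theorem eq_neg_pow_of_sq_eq {q : ℕ} (hq : 2 ≤ q) {S T : ℂ} (M : ℕ)
    (hS : S ^ 2 = ((-(q : ℂ)) ^ M) ^ 2) (hT : IsIntegral ℤ T) (h : S = 1 + (q + 1) * T) :
    S = (-(q : ℂ)) ^ M := by
  have hq0 : (q : ℂ) + 1 ≠ 0 := by exact_mod_cast Nat.succ_ne_zero q
  rcases sq_eq_sq_iff_eq_or_eq_neg.1 hS with h1 | h1
  · exact h1
  exfalso
  -- With the wrong sign T is rational, hence an integer, and q + 1 would divide 2.
  have hTq : T = algebraMap ℚ ℂ ((-(-(q : ℚ)) ^ M - 1) / (q + 1)) := by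
    simp only [map_div₀, map_sub, map_neg, map_pow, map_natCast, map_one, map_add]
    rw [eq_div_iff hq0, ← h1, h]; ring
  rw [hTq, isIntegral_algebraMap_iff (algebraMap ℚ ℂ).injective] at hT
  obtain ⟨y, hy⟩ := IsIntegrallyClosed.isIntegral_iff.1 hT
  have hq1 : (q : ℚ) + 1 ≠ 0 := by positivity
  rw [eq_div_iff hq1] at hy
  have hy' : y * ((q : ℤ) + 1) = -(-(q : ℤ)) ^ M - 1 := by
    have : (algebraMap ℤ ℚ) y = (y : ℚ) := rfl
    rw [this] at hy
    exact_mod_cast hy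
  have h2 : ((q : ℤ) + 1) ∣ (-(q : ℤ)) ^ M - 1 := by
    have := sub_dvd_pow_sub_pow (-(q : ℤ)) 1 M
    rw [one_pow] at this
    exact (dvd_trans ⟨-1, by ring⟩ this)
  have h3 : ((q : ℤ) + 1) ∣ 2 := by
    have h4 : ((q : ℤ) + 1) ∣ -(-(q : ℤ)) ^ M - 1 := ⟨y, by rw [← hy']; ring⟩
    have := dvd_add h2 h4
    ring_nf at this
    rw [← dvd_neg]
    convert this using 1
    ring
  have := Int.le_of_dvd (by norm_num) h3
  omega

/-! ### Character sums and their moments -/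

/-- The standard additive character composed with the absolute trace. -/
noncomputable def traceChar (p : ℕ) [Fact p.Prime] (K : Type*) [Field K] [Algebra (ZMod p) K] :
    AddChar K ℂ :=
  ZMod.stdAddChar.compAddMonoidHom (Algebra.trace (ZMod p) K).toAddMonoidHom

section traceChar

variable {p : ℕ} [Fact p.Prime] {K : Type*} [Field K] [Algebra (ZMod p) K]

theorem traceChar_eq_one_iff (x : K) :
    traceChar p K x = 1 ↔ Algebra.trace (ZMod p) K x = 0 := by
  rw [← AddChar.map_zero_eq_one (ZMod.stdAddChar (N := p)), ← ZMod.injective_stdAddChar.eq_iff]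
  rfl

theorem isIntegral_traceChar (x : K) : IsIntegral ℤ (traceChar p K x) := by
  refine IsIntegral.of_pow (Fact.out : p.Prime).pos ?_
  rw [← AddChar.map_nsmul_eq_pow, ← Nat.cast_smul_eq_nsmul (ZMod p), CharP.cast_eq_zero,
    zero_smul, AddChar.map_zero_eq_one]
  exact isIntegral_one

theorem sum_traceChar_mul [Fintype K] [DecidableEq K] (b : K) :
    ∑ a, traceChar p K (a * b) = if b = 0 then (Fintype.card K : ℂ) else 0 := by
  have hprim : (traceChar p K).IsPrimitive := by
    intro a ha h
    refine ha ((traceForm_nondegenerate (ZMod p) K).1 a fun b => ?_)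
    rw [Algebra.traceForm_apply, ← traceChar_eq_one_iff, ← AddChar.mulShift_apply, h,
      AddChar.one_apply]
  have := AddChar.sum_mulShift b hprim
  rw [this]
  split_ifs <;> simp

end traceChar

section charSum

variable {p : ℕ} [Fact p.Prime] {K : Type*} [Field K] [Fintype K] [Algebra (ZMod p) K]

/-- The Walsh coefficient of `Q` at `0`, twisted by `a`. -/
noncomputable def walsh (p : ℕ) [Fact p.Prime] {K : Type*} [Field K] [Fintype K]
    [Algebra (ZMod p) K] (Q : K → K) (a : K) : ℂ := ∑ x, traceChar p K (a * Q x)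

/-- The substitution x ↦ cx shows that Q and -Q have the same sum, so the plain square expands as a
squared modulus would. -/
theorem walsh_sq_eq_sum {Q : K → K} {c : K} (hc : c ≠ 0) (hQ : ∀ x, Q (c * x) = - Q x) (a : K) :
    walsh p Q a ^ 2 = ∑ y, ∑ x, traceChar p K (a * (Q x - Q y)) := by
  have h : walsh p Q a = ∑ y, traceChar p K (-(a * Q y)) := by
    unfold walsh
    rw [← Equiv.sum_comp (Equiv.mulLeft₀ c hc)]
    simp [hQ]
  rw [sq]
  nth_rewrite 1 [h]
  unfold walsh
  rw [Finset.sum_mul_sum]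
  refine Finset.sum_congr rfl fun y _ => Finset.sum_congr rfl fun x _ => ?_
  rw [← AddChar.map_add_eq_mul]
  congr 1; ring

/-- After setting x = y + s, the sum over y is, up to a constant factor, a sum of an additive
character, trivial exactly when s lies in the radical. -/
theorem walsh_sq_eq_card {q : ℕ} {F : K → K} (h : IsHermitianLike q (fun x => F x - F 0))
    {c : K} (hc : c ≠ 0) (hcF : ∀ x, F (c * x) - F 0 = - (F x - F 0)) (a : K)
    (hmem : ∀ s, s ∈ traceVanishingSpace p F a ↔
      ∀ y, Algebra.trace (ZMod p) K (a * QuadraticMap.polar (fun x => F x - F 0) y s) = 0) :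
    walsh p (fun x => F x - F 0) a ^ 2 =
      Fintype.card K * Nat.card (traceVanishingSpace p F a) := by
  classical
  rw [walsh_sq_eq_sum hc hcF]
  have h1 : ∀ y, ∑ x, traceChar p K (a * (F x - F 0 - (F y - F 0))) =
      ∑ s, traceChar p K (a * (F (y + s) - F y)) := by
    intro y
    rw [← Equiv.sum_comp (Equiv.addLeft y)]
    simp
  rw [Finset.sum_congr rfl fun y _ => h1 y, Finset.sum_comm]
  have h2 : ∀ s, ∑ y, traceChar p K (a * (F (y + s) - F y)) =
      if s ∈ traceVanishingSpace p F a then (Fintype.card K : ℂ) else 0 := by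
    intro s
    split_ifs with hs
    · rw [Finset.sum_congr rfl fun y _ => (traceChar_eq_one_iff _).2 (hs y)]
      simp
    · let χ : AddChar K ℂ :=
        { toFun := fun y => traceChar p K (a * QuadraticMap.polar (fun x => F x - F 0) y s)
          map_zero_eq_one' := by
            simp [QuadraticMap.polar]
          map_add_eq_mul' := fun x y => by
            rw [h.polar_add_left, mul_add, AddChar.map_add_eq_mul] }
      have hχ : χ ≠ 1 := by
        intro h1
        refine hs ((hmem s).2 fun y => (traceChar_eq_one_iff _).1 ?_)
        have := DFunLike.congr_fun h1 y
        exact this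
      have h3 := AddChar.sum_eq_zero_of_ne_one hχ
      have h4 : ∀ y, traceChar p K (a * (F (y + s) - F y)) =
          χ y * traceChar p K (a * (F s - F 0)) := by
        intro y
        change _ = traceChar p K (a * QuadraticMap.polar (fun x => F x - F 0) y s) * _
        rw [← AddChar.map_add_eq_mul, QuadraticMap.polar]
        congr 1; ring
      rw [Finset.sum_congr rfl fun y _ => h4 y, ← Finset.sum_mul, h3, zero_mul]
  rw [Finset.sum_congr rfl fun s _ => h2 s, ← Finset.sum_filter, Finset.sum_const, nsmul_eq_mul,
    mul_comm]
  congr 2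
  rw [Nat.card_eq_fintype_card]
  exact (Fintype.card_subtype _).symm

theorem card_filter_pow_eq [DecidableEq K] {d m : ℕ} (hd : 0 < d)
    (hm : Nat.gcd d (Fintype.card K - 1) = m) {x : K} (hx : x ≠ 0) :
    (Finset.univ.filter fun y : K => y ^ d = x ^ d).card = m := by
  rw [← hm, ← card_pow_eq_pow d hd hx, Nat.card_eq_fintype_card, Fintype.card_subtype]

/-- The term x = 0 contributes 1; the other terms are constant on fibres of x ↦ x^d, each of size m.
-/
theorem exists_isIntegral_walsh_eq {d m : ℕ} (hd : 0 < d)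
    (hm : Nat.gcd d (Fintype.card K - 1) = m) {Q H : K → K} (hQ : ∀ x, Q x = H (x ^ d))
    (hQ0 : Q 0 = 0) (a : K) : ∃ T : ℂ, IsIntegral ℤ T ∧ walsh p Q a = 1 + m * T := by
  classical
  refine ⟨∑ b ∈ (Finset.univ.erase (0 : K)).image (· ^ d), traceChar p K (a * H b),
    IsIntegral.sum _ fun b _ => isIntegral_traceChar _, ?_⟩
  unfold walsh
  rw [← Finset.add_sum_erase _ _ (Finset.mem_univ (0 : K)), hQ0, mul_zero,
    AddChar.map_zero_eq_one]
  congr 1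
  simp only [hQ]
  rw [Finset.sum_comp (fun b => traceChar p K (a * H b)) (fun x : K => x ^ d), Finset.mul_sum]
  refine Finset.sum_congr rfl fun b hb => ?_
  obtain ⟨x, hx, rfl⟩ := Finset.mem_image.1 hb
  rw [nsmul_eq_mul]
  congr 2
  have hx0 : x ≠ 0 := (Finset.mem_erase.1 hx).1
  rw [← card_filter_pow_eq hd hm hx0]
  congr 1
  ext y
  simp only [Finset.mem_filter, Finset.mem_erase, Finset.mem_univ, and_true, true_and,
    and_iff_right_iff_imp]
  rintro hy rfl
  rw [zero_pow hd.ne'] at hy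
  exact pow_ne_zero d hx0 hy.symm

theorem sum_walsh {Q : K → K} (hQ : ∀ x, Q x = 0 ↔ x = 0) :
    ∑ a, walsh p Q a = Fintype.card K := by
  classical
  unfold walsh
  rw [Finset.sum_comm]
  simp [sum_traceChar_mul, hQ]

theorem sum_walsh_sq {d m : ℕ} (hd : 0 < d)
    (hm : Nat.gcd d (Fintype.card K - 1) = m) {Q : K → K} (hQ : ∀ x y, Q x = Q y ↔ x ^ d = y ^ d)
    {c : K} (hc : c ≠ 0) (hcQ : ∀ x, Q (c * x) = - Q x) :
    ∑ a, walsh p Q a ^ 2 =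
      (Fintype.card K : ℂ) * (1 + ((Fintype.card K : ℂ) - 1) * m) := by
  classical
  simp only [walsh_sq_eq_sum hc hcQ]
  rw [Finset.sum_comm]
  have h : ∀ y : K, ∑ a, ∑ x, traceChar p K (a * (Q x - Q y)) =
      (Fintype.card K : ℂ) * (Finset.univ.filter fun x : K => x ^ d = y ^ d).card := by
    intro y
    rw [Finset.sum_comm]
    simp only [sum_traceChar_mul, sub_eq_zero, hQ]
    rw [← Finset.sum_filter, Finset.sum_const, nsmul_eq_mul, mul_comm]
  rw [Finset.sum_congr rfl fun y _ => h y, ← Finset.mul_sum,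
    ← Finset.add_sum_erase _ _ (Finset.mem_univ (0 : K))]
  congr 2
  · have : (Finset.univ.filter fun x : K => x ^ d = 0 ^ d) = {0} := by
      ext x
      simp [zero_pow hd.ne', hd.ne']
    rw [this]; simp
  · rw [Finset.sum_congr rfl fun y hy => congrArg Nat.cast
      (card_filter_pow_eq hd hm (Finset.mem_erase.1 hy).1), Finset.sum_const,
      Finset.card_erase_of_mem (Finset.mem_univ _), Finset.card_univ, nsmul_eq_mul,
      Nat.cast_sub Fintype.card_pos, Nat.cast_one]

end charSum

/-! ### Integers of the form (-q)^r with prescribed moments -/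

/-- No power of -q lies strictly between -q and 1. -/
theorem neg_pow_sub_one_mul_add_nonneg {q : ℤ} (hq : 1 ≤ q) (r : ℕ) :
    0 ≤ ((-q) ^ r - 1) * ((-q) ^ r + q) := by
  rcases r with _ | r
  · simp
  have h1 : 1 ≤ q ^ r := one_le_pow₀ hq
  rcases Nat.even_or_odd (r + 1) with h | h
  · rw [h.neg_pow, pow_succ]
    exact mul_nonneg (by nlinarith) (by nlinarith)
  · rw [h.neg_pow, pow_succ]
    exact mul_nonneg_of_nonpos_of_nonpos (by nlinarith) (by nlinarith)

theorem le_one_of_neg_pow_sub_one_mul_add_eq_zero {q : ℤ} (hq : 2 ≤ q) {r : ℕ}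
    (h : ((-q) ^ r - 1) * ((-q) ^ r + q) = 0) : r = 0 ∨ r = 1 := by
  have hinj : ∀ s : ℕ, ((-q) ^ r).natAbs = (q ^ s).natAbs → r = s := by
    intro s hs
    rw [Int.natAbs_pow, Int.natAbs_pow, Int.natAbs_neg] at hs
    exact Nat.pow_right_injective (by omega) hs
  rcases mul_eq_zero.1 h with h | h
  · exact Or.inl (hinj 0 (by rw [sub_eq_zero.1 h]; simp))
  · exact Or.inr (hinj 1 (by rw [eq_neg_of_add_eq_zero_left h]; simp))

/-- If `∑ (-q) ^ r a` over nonzero `a` vanishes and the mean square is `q`, each `r a ≤ 1`. -/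
theorem le_one_of_sum_neg_pow {ι : Type*} {q : ℤ} (hq : 2 ≤ q) (s : Finset ι) (r : ι → ℕ)
    (h1 : ∑ a ∈ s, (-q) ^ r a = 0) (h2 : ∑ a ∈ s, ((-q) ^ r a) ^ 2 = s.card * q) {a : ι}
    (ha : a ∈ s) : r a = 0 ∨ r a = 1 := by
  have h3 : ∑ a ∈ s, ((-q) ^ r a - 1) * ((-q) ^ r a + q) = 0 := by
    have : ∀ a, ((-q) ^ r a - 1) * ((-q) ^ r a + q) =
        ((-q) ^ r a) ^ 2 + (q - 1) * (-q) ^ r a - q := fun a => by ring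
    simp only [this]
    rw [Finset.sum_sub_distrib, Finset.sum_add_distrib, ← Finset.mul_sum, h1, h2,
      Finset.sum_const, nsmul_eq_mul]
    ring
  exact le_one_of_neg_pow_sub_one_mul_add_eq_zero hq ((Finset.sum_eq_zero_iff_of_nonneg
    fun a _ => neg_pow_sub_one_mul_add_nonneg (by omega) _).1 h3 a ha)

/-! ### The dichotomy for |E_a| -/

theorem mainTheorem2 (p : ℕ) [Fact p.Prime] (n d t k : ℕ) (hd : 0 < d) (ht : 0 < t) (hk : 0 < k)
    (hn : n = 2 * k * t) (hgcd : Nat.gcd d (p ^ n - 1) = p ^ t + 1)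
    (K : Type*) [Field K] [Fintype K] [Algebra (ZMod p) K] (hK : Fintype.card K = p ^ n)
    (F G : K → K) (hFG : ∀ x, F x = G (x ^ d)) (hF : IsQuadraticMap p F)
    (hG : Set.InjOn G (powerSet K d)) (a : K) (ha : a ≠ 0) :
    Nat.card (traceVanishingSpace p F a) = 1 ∨
      Nat.card (traceVanishingSpace p F a) = p ^ (2 * t) := by
  classical
  have : CharP K p := charP_of_injective_algebraMap (algebraMap (ZMod p) K).injective p
  subst hn
  rw [← hK] at hgcd
  have hq : 2 ≤ p ^ t := Nat.one_lt_pow ht.ne' (Fact.out : p.Prime).one_lt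
  obtain ⟨ζ, hζ⟩ := exists_orderOf_eq (K := K) (hgcd ▸ Nat.gcd_dvd_right d _)
  have hζd : ζ ^ d = 1 := orderOf_dvd_iff_pow_eq_one.1 (hζ ▸ hgcd ▸ Nat.gcd_dvd_left d _)
  have hFζ : ∀ x, F (ζ * x) = F x := by
    intro x
    rw [hFG, hFG, mul_pow, hζd, one_mul]
  have hH := isHermitianLike_of_isQuadraticMap p ht hF hζ hFζ
  obtain ⟨c, hc, hc1⟩ := exists_pow_add_one_eq_neg_one (K := K) hK
  have hc0 : c ≠ 0 := by rintro rfl; simp at hc1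
  have hcF : ∀ x, F (c * x) - F 0 = -(F x - F 0) := fun x => hH.map_mul c x hc hc1
  have hζ1 : ζ ≠ 1 := by
    rintro rfl
    rw [orderOf_one] at hζ
    omega
  -- ζ^q is the inverse of ζ, so applying the q-power map twice returns ζ.
  have hζq : ζ ∈ frobeniusFixed K p (t * 2) := by
    have h1 : ζ ^ p ^ t * ζ = 1 := by rw [← pow_succ, ← hζ, pow_orderOf_eq_one]
    have h2 : (ζ ^ p ^ t) ^ p ^ t * ζ ^ p ^ t = 1 := by rw [← mul_pow, h1, one_pow]
    rw [mem_frobeniusFixed, pow_mul, sq, pow_mul]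
    exact mul_right_cancel₀ (right_ne_zero_of_mul_eq_one h2) (h2.trans (mul_comm _ ζ ▸ h1).symm)
  have hmem := fun a s => hH.mem_traceVanishingSpace (p := p) hζ1
    (by
      rw [← pow_mul]
      exact mem_frobeniusFixed.1 (sub_mem hζq (one_mem _))) hFζ a s
  choose r hr using fun a => hH.exists_card_traceVanishingSpace ht hK a (hmem a)
  have hS : ∀ a, walsh p (fun x => F x - F 0) a = (-((p ^ t : ℕ) : ℂ)) ^ (k + r a) := by
    intro a
    obtain ⟨T, hT, hST⟩ := exists_isIntegral_walsh_eq (p := p) hd hgcd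
      (Q := fun x => F x - F 0) (H := fun x => G x - F 0) (fun x => by simp only [hFG x])
      (sub_self _) a
    refine eq_neg_pow_of_sq_eq hq _ ?_ hT (by rw [hST]; push_cast; ring)
    rw [walsh_sq_eq_card hH hc0 hcF a (hmem a), hr, hK, ← pow_mul, Even.neg_pow ⟨k + r a, by ring⟩]
    push_cast
    rw [← pow_add, ← pow_mul]
    congr 1; ring
  have hinj : ∀ x y, F x - F 0 = F y - F 0 ↔ x ^ d = y ^ d := by
    intro x y
    rw [sub_left_inj, hFG, hFG]
    exact ⟨fun h => hG ⟨x, rfl⟩ ⟨y, rfl⟩ h, fun h => by rw [h]⟩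
  have hsum := sum_walsh (p := p) (K := K) (Q := fun x => F x - F 0) (fun x => by
    have := hinj x 0
    rw [sub_self, zero_pow hd.ne', pow_eq_zero_iff hd.ne'] at this
    exact this)
  have hsq := sum_walsh_sq (p := p) hd hgcd hinj hc0 hcF
  have hr0 : r 0 = k := by
    have h0 := hr 0
    have : traceVanishingSpace p F 0 = ⊤ := by
      rw [eq_top_iff]
      intro s _ y
      simp
    rw [this, Nat.card_congr (Submodule.topEquiv (R := ZMod p) (M := K)).toEquiv,
      Nat.card_eq_fintype_card, hK] at h0
    have := Nat.pow_right_injective (Fact.out : p.Prime).two_le h0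
    have h3 : (2 * t) * k = 2 * t * r 0 := by rw [← this]; ring
    exact (Nat.eq_of_mul_eq_mul_left (by omega) h3).symm
  have hcard : (Fintype.card K : ℂ) = ((-((p ^ t : ℕ) : ℂ)) ^ k) ^ 2 := by
    rw [hK, ← pow_mul, Even.neg_pow ⟨k, by ring⟩]
    push_cast
    rw [← pow_mul]
    congr 1; ring
  have hq0 : (-((p ^ t : ℕ) : ℂ)) ^ k ≠ 0 := by
    refine pow_ne_zero _ (neg_ne_zero.2 ?_)
    exact_mod_cast (by omega : p ^ t ≠ 0)
  have hcs : (((Finset.univ.erase (0 : K)).card : ℕ) : ℂ) = Fintype.card K - 1 := by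
    rw [Finset.card_erase_of_mem (Finset.mem_univ _), Finset.card_univ,
      Nat.cast_sub Fintype.card_pos, Nat.cast_one]
  simp only [hS, pow_add] at hsum hsq
  rw [← Finset.add_sum_erase _ _ (Finset.mem_univ (0 : K)), hr0, ← Finset.mul_sum] at hsum
  simp only [mul_pow] at hsq
  rw [← Finset.add_sum_erase _ _ (Finset.mem_univ (0 : K)), hr0, ← Finset.mul_sum] at hsq
  have key := le_one_of_sum_neg_pow (q := ((p ^ t : ℕ) : ℤ)) (by exact_mod_cast hq)
    (Finset.univ.erase (0 : K)) r ?_ ?_ (Finset.mem_erase.2 ⟨ha, Finset.mem_univ a⟩)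
  · rw [hr]
    rcases key with h | h
    · left; rw [h]; simp
    · right; rw [h, mul_one]
  -- The term a = 0 equals |K|, which is already the whole first moment.
  · have : ∑ x ∈ Finset.univ.erase (0 : K), (-((p ^ t : ℕ) : ℂ)) ^ r x = 0 := by
      refine (mul_eq_zero.1 ?_).resolve_left hq0
      rw [hcard] at hsum
      linear_combination hsum
    exact_mod_cast this
  · have : ∑ x ∈ Finset.univ.erase (0 : K), ((-((p ^ t : ℕ) : ℂ)) ^ r x) ^ 2 =
        ((Finset.univ.erase (0 : K)).card : ℂ) * ((p ^ t : ℕ) : ℂ) := by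
      refine mul_left_cancel₀ (pow_ne_zero 2 hq0) ?_
      rw [hcs]
      rw [hcard] at hsq ⊢
      push_cast at hsq ⊢
      linear_combination hsq
    exact_mod_cast this
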